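/- A median algebra is a set $X$ with a ternary operation $m\colon X^3\to X$, written $m(x,y,z)=xyz$, which is invariant under all permutations of its three arguments and satisfies $xyy=y$ and $(xyz)uv=x(yuv)(zuv)$. A map between median algebras is median-preserving if $f(xyz)=f(x)f(y)f(z)$ for all $x,y,z$. The hypercube $\{0,1\}^n$ carries the coordinatewise majority median, and $[0,1]$ carries the median of its linear order. The rank $\operatorname{rank}(X)\in\mathbb N\cup\{\infty\}$ is the supremum of all $n\in\mathbb N$ for which there is an injective median-preserving map $\{0,1\}^n\to X$ (with $\sup\varnothing=0$). A topological median algebra is a median algebra with a Hausdorff topology for which $m\colon X^3\to X$ is continuous. A finite sequence $f_1,\dots,f_k$ of real functions on $X$ is independent if there are real numbers $a<b$ such that $$\bigcap_{i\in P} f_i^{-1}(-\infty,a]\ \cap\ \bigcap_{j\in M} f_j^{-1}[b,\infty)\neq\varnothing$$ for all disjoint $P,M\subseteq\{1,\dots,k\}$. For a family $\mathcal F$ of real functions on $X$, the independence number $\operatorname{ind}(\mathcal F)\in\mathbb N\cup\{\infty\}$ is the supremum of all $k\in\mathbb N$ such that $\mathcal F$ contains an independent sequence of length $k$ (with $\sup\varnothing=0$).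 Theorem. Let $X$ be a topological median algebra, and let $\mathcal{MC}$ be the family of all continuous median-preserving maps $f\colon X\to[0,1]$. 1. $\operatorname{ind}(\mathcal{MC})\le\operatorname{rank}(X)$. 2. If $X$ is compact and $\operatorname{rank}(X)<\infty$, then $\operatorname{ind}(\mathcal{MC})=\operatorname{rank}(X)$. -/

import Mathlib

/-- A median algebra: a set with a ternary operation `med x y z`, invariant under all permutations
of its arguments (the two transpositions below generate them), with `med x y y = y` and
`med (med x y z) u v = med x (med y u v) (med z u v)`. -/
class MedianAlgebra (X : Type*) where
  med : X → X → X → X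
  med_swap_left : ∀ x y z : X, med x y z = med y x z
  med_swap_right : ∀ x y z : X, med x y z = med x z y
  med_self : ∀ x y : X, med x y y = y
  med_med : ∀ x y z u v : X, med (med x y z) u v = med x (med y u v) (med z u v)

namespace MedianAlgebra

/-- Every distributive lattice is a median algebra with
`med a b c = (a ∧ b) ∨ (b ∧ c) ∨ (c ∧ a)`. On the Boolean hypercube `Fin n → Bool` this is the
coordinatewise majority, on a linear order such as the unit interval `[0,1]` it is the middle one
of the three points. -/
instance ofDistribLattice {L : Type*} [DistribLattice L] : MedianAlgebra L where
  med a b c := (a ⊓ b) ⊔ (b ⊓ c) ⊔ (c ⊓ a)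
  med_swap_left x y z := by
    rw [inf_comm x y, inf_comm y z, inf_comm z x, sup_assoc, sup_comm (z ⊓ y), ← sup_assoc]
  med_swap_right x y z := by
    rw [inf_comm x y, inf_comm y z, inf_comm z x, sup_comm, ← sup_assoc, sup_assoc,
      sup_comm (y ⊓ x), ← sup_assoc]
  med_self x y := by
    rw [inf_idem, inf_comm y x, sup_eq_right.2 (inf_le_right : x ⊓ y ≤ y),
      sup_eq_left.2 (inf_le_right : x ⊓ y ≤ y)]
  med_med x y z u v := by
    have h (t : L) : u ⊓ v ⊔ u ⊓ v ⊓ t = u ⊓ v := sup_inf_self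
    have hx := h x
    have hy := h y
    have hz := h z
    have hyz := h (y ⊓ z)
    simp only [inf_sup_left, inf_sup_right]
    grind only

/-- Median-preserving maps (homomorphisms of median algebras). -/
def IsMedianPreserving {X Y : Type*} [MedianAlgebra X] [MedianAlgebra Y] (f : X → Y) : Prop :=
  ∀ x y z : X, f (med x y z) = med (f x) (f y) (f z)

/-- The rank: the supremum in `ℕ ∪ {∞}` of all `n` such that the Boolean hypercube `{0,1}ⁿ` embeds
into `X` as a median subalgebra. -/
noncomputable def rank (X : Type*) [MedianAlgebra X] : ℕ∞ :=
  ⨆ (n : ℕ) (_ : ∃ φ : (Fin n → Bool) → X, Function.Injective φ ∧ IsMedianPreserving φ), (n : ℕ∞)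

/-- A topological median algebra: a Hausdorff space with a (jointly) continuous median. -/
class IsTopological (X : Type*) [MedianAlgebra X] [TopologicalSpace X] : Prop
    extends T2Space X where
  continuous_med : Continuous fun p : X × X × X => med p.1 p.2.1 p.2.2

/-- A finite sequence of real functions on a set is independent in the sense of Rosenthal:
there are real numbers `a < b`, the same for all the functions, such that any choice of disjoint
sets `P`, `M` of indices is realized at some point of `X`. -/
def IsIndependent {X : Type*} {k : ℕ} (f : Fin k → X → ℝ) : Prop :=
  ∃ a b : ℝ, a < b ∧ ∀ P M : Finset (Fin k), Disjoint P M →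
    ((⋂ i ∈ P, f i ⁻¹' Set.Iic a) ∩ ⋂ j ∈ M, f j ⁻¹' Set.Ici b).Nonempty

/-- The independence number of a family `F` of real functions on `X`: the supremum in `ℕ ∪ {∞}` of
the lengths of the finite independent sequences in `F`. -/
noncomputable def ind {X : Type*} (F : Set (X → ℝ)) : ℕ∞ :=
  ⨆ (k : ℕ) (_ : ∃ f : Fin k → X → ℝ, (∀ i, f i ∈ F) ∧ IsIndependent f), (k : ℕ∞)

/-- The family of all continuous median-preserving maps `X → [0,1]`, as real functions on `X`. -/
def MC (X : Type*) [MedianAlgebra X] [TopologicalSpace X] : Set (X → ℝ) :=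
  {g | ∃ f : X → unitInterval, Continuous f ∧ IsMedianPreserving f ∧ g = fun x => (f x : ℝ)}

end MedianAlgebra

/-!
Every interval `[a, b]` of a median algebra is a bounded distributive lattice, on which the ambient
median is the lattice median, and `x ↦ med x a b` is a median-preserving projection onto it
(`Interval`). In a distributive lattice a finite set no member of which lies above a meet of others
spans a Boolean cube (`IsMeetIrredundant.exists_cube`). The rank therefore bounds the breadth of all
intervals.

*Upper bound.* Let `f₁, …, f_k` be independent, with levels `α < β`. Project the points realizing
the sign patterns to the interval between the all-low point and the all-high point. This does not
change their sign patterns, and the `k` points at which exactly one `f_i` is low form a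
meet-irredundant set, hence span a `k`-cube (`le_rank_of_isIndependent`).

*Lower bound.* Given a cube, it suffices to find for each coordinate a continuous lattice
homomorphism to `[0, 1]`, sending bottom to `0` and top to `1`, on the interval spanned by an edge;
its composition with the projection to that interval restricts to the coordinate on the whole cube
(`exists_isIndependent`). The interval is a compact topological lattice of finite breadth, and the
claim is that each of its elements is the join of the elements well below it
(`exists_wellBelow_not_le`), as in a completely distributive lattice:
* since `n`-fold meets are continuous and every finite meet is an `n`-fold one, a point `x ≰ y` has
  a neighbourhood `V` that generates a filter `G` with a lower bound `g ≰ y`;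
* by finite breadth the complement of `G` is a finite union of ideals whose complements are filters
  (`exists_finite_ideal_cover`). The infima of these filters have a join above `g`, so one of these
  infima, `c`, is not below `y`. Every element lies above `c` or below the supremum of the
  corresponding ideal, and this supremum is not above `x` because the ideal misses `V`.

The relation `WellBelow` then interpolates, and a dyadic chain for it defines the homomorphism as in
Urysohn's lemma (`exists_continuous_hom_of_wellBelow`).
-/

namespace MedianAlgebra

open Set Filter Topology

/-! ### Intervals as distributive lattices -/

section Algebra

theorem isMedianPreserving_of_map_inf_sup {L M : Type*} [DistribLattice L] [DistribLattice M]
    {f : L → M} (hi : ∀ x y, f (x ⊓ y) = f x ⊓ f y) (hs : ∀ x y, f (x ⊔ y) = f x ⊔ f y) :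
    IsMedianPreserving f := fun x y z => by
  simp only [med, hi, hs]

theorem IsMedianPreserving.comp {X Y Z : Type*} [MedianAlgebra X] [MedianAlgebra Y]
    [MedianAlgebra Z] {g : Y → Z} {f : X → Y} (hg : IsMedianPreserving g)
    (hf : IsMedianPreserving f) : IsMedianPreserving (g ∘ f) := fun x y z => by
  rw [Function.comp, hf x y z, hg]; rfl

variable {X : Type*} [MedianAlgebra X]

theorem med_rotate (x y z : X) : med x y z = med y z x := by
  rw [med_swap_left, med_swap_right]

theorem med_self_left (x y : X) : med x x y = x := by
  rw [← med_rotate, med_self]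

theorem med_self_outer (x y : X) : med x y x = x := by
  rw [med_swap_left, med_self]

theorem med_med_mid (x y z u v : X) : med (med x y z) u v = med y (med x u v) (med z u v) := by
  rw [med_swap_left x y z, med_med]

theorem med_med_right (x y z u v : X) : med (med x y z) u v = med z (med x u v) (med y u v) := by
  rw [← med_rotate z x y, med_med]

theorem proj_proj (u v x : X) : med (med x u v) u v = med x u v := by
  rw [med_med, med_self_left, med_self_outer]

/-- The projection `x ↦ med x u v` to the interval between `u` and `v` preserves medians. -/
theorem proj_med (u v x y z : X) :
    med (med x y z) u v = med (med x u v) (med y u v) (med z u v) := by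
  rw [← proj_proj, med_med x y z, med_med_mid x (med y u v), proj_proj, med_swap_left]

theorem med_assoc (a x y z : X) : med a (med a x y) z = med a x (med a y z) := by
  rw [med_swap_left a (med a x y), med_med_mid, med_self_left, med_swap_left x a,
    med_swap_left y a]

theorem med_absorb {a b x : X} (h : med x a b = x) (y : X) : med b x (med a x y) = x := by
  rw [med_rotate, med_swap_left, med_med_right, med_swap_left a x, h, med_self_left, med_self]

theorem med_distrib (a b x y z : X) :
    med b x (med a y z) = med a (med b x y) (med b x z) := by
  have h (w : X) : med b x w = med w x b := by rw [med_rotate, ← med_swap_left, med_swap_right,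
    med_swap_left, med_rotate]
  rw [h, h, h, med_med]

/-- The interval between two points `a` and `b`: the points fixed by the projection
`x ↦ med x a b`. It is bundled as a type so that it can carry the lattice structure with bottom `a`
and top `b`. -/
@[ext]
structure Interval (a b : X) where
  val : X
  proj_val : med val a b = val

namespace Interval

variable {a b : X}

theorem val_injective : Function.Injective (val : Interval a b → X) := fun _ _ => Interval.ext

theorem swap (x : Interval a b) : med x.1 b a = x.1 := by
  rw [med_swap_right, x.2]

instance : Max (Interval a b) :=
  ⟨fun x y => ⟨med b x.1 y.1, by rw [proj_med, x.2, y.2, med_self_outer b a]⟩⟩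

instance : Min (Interval a b) :=
  ⟨fun x y => ⟨med a x.1 y.1, by rw [proj_med, x.2, y.2, med_self_left]⟩⟩

theorem val_inf (x y : Interval a b) : (x ⊓ y).1 = med a x.1 y.1 := rfl

instance : Lattice (Interval a b) :=
  Lattice.mk' (fun _ _ => Interval.ext (med_swap_right _ _ _))
    (fun _ _ _ => Interval.ext (med_assoc _ _ _ _))
    (fun _ _ => Interval.ext (med_swap_right _ _ _))
    (fun _ _ _ => Interval.ext (med_assoc _ _ _ _))
    (fun x _ => Interval.ext (med_absorb x.2 _))
    (fun x _ => Interval.ext (med_absorb x.swap _))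

/-- The lattice structure with `x ⊓ y = med a x y` and `x ⊔ y = med b x y`. -/
instance : DistribLattice (Interval a b) where
  le_sup_inf x y z := le_of_eq (Interval.ext (med_distrib a b x.1 y.1 z.1).symm)

instance : BoundedOrder (Interval a b) where
  bot := ⟨a, med_self_left _ _⟩
  top := ⟨b, med_self_outer _ _⟩
  bot_le x := inf_eq_left.1 (Interval.ext (med_self_left a x.1))
  le_top x := sup_eq_right.1 (Interval.ext (med_self_outer b x.1))

theorem med_inf_med (a x y z : X) : med a (med x y z) (med a y z) = med a y z := by
  rw [med_swap_left, med_med, med_swap_left y a, med_swap_left z a, ← med_assoc, med_self,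
    med_swap_right a y z, ← med_assoc a z z y, med_self, med_self]

/-- The median of the ambient median algebra restricts on an interval to the median of the
distributive lattice. -/
theorem isMedianPreserving_val : IsMedianPreserving (Interval.val : Interval a b → X) := by
  intro x y z
  have hm : med (med x.1 y.1 z.1) a b = med x.1 y.1 z.1 := by rw [proj_med, x.2, y.2, z.2]
  let m : Interval a b := ⟨med x.1 y.1 z.1, hm⟩
  have key : med x y z = m := by
    have i1 : y ⊓ z ≤ m := inf_eq_right.1 (Interval.ext (med_inf_med a x.1 y.1 z.1))
    have i2 : z ⊓ x ≤ m := inf_eq_right.1 (Interval.ext (by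
      have := med_inf_med a y.1 z.1 x.1; rwa [← med_rotate x.1 y.1 z.1] at this))
    have i3 : x ⊓ y ≤ m := inf_eq_right.1 (Interval.ext (by
      have := med_inf_med a z.1 x.1 y.1; rwa [med_rotate z.1] at this))
    have s1 : m ≤ y ⊔ z := sup_eq_right.1 (Interval.ext (med_inf_med b x.1 y.1 z.1))
    have s2 : m ≤ z ⊔ x := sup_eq_right.1 (Interval.ext (by
      have := med_inf_med b y.1 z.1 x.1; rwa [← med_rotate x.1 y.1 z.1] at this))
    have s3 : m ≤ x ⊔ y := sup_eq_right.1 (Interval.ext (by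
      have := med_inf_med b z.1 x.1 y.1; rwa [med_rotate z.1] at this))
    refine le_antisymm (sup_le (sup_le i3 i1) i2) ?_
    refine (le_inf (le_inf s3 s1) s2).trans (le_of_eq ?_)
    have h1 : (x ⊔ y) ⊓ (y ⊔ z) = y ⊔ (z ⊓ x) := by
      rw [sup_comm x y, ← sup_inf_left, inf_comm]
    change _ = (x ⊓ y) ⊔ (y ⊓ z) ⊔ (z ⊓ x)
    rw [h1, inf_sup_right, inf_sup_left, inf_eq_left.2 (inf_le_left.trans le_sup_left),
      inf_comm y x, inf_comm y z, sup_comm (z ⊓ y)]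
  exact congrArg Interval.val key

/-- The projection `x ↦ med x a b` of a median algebra to one of its intervals. -/
def proj (a b : X) (x : X) : Interval a b := ⟨med x a b, proj_proj a b x⟩

theorem isMedianPreserving_proj (a b : X) : IsMedianPreserving (proj a b) := fun x y z =>
  Interval.ext <| by
    rw [isMedianPreserving_val]
    exact proj_med a b x y z

end Interval

/-! ### Irredundant meets, cubes and the rank -/

/-- No member of the finite set `s` lies above the meet of other members of `s`. -/
def IsMeetIrredundant {L : Type*} [DistribLattice L] [OrderTop L] (s : Finset L) : Prop :=
  ∀ x ∈ s, ∀ t ⊆ s, x ∉ t → ¬ t.inf id ≤ x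

/-- The cube spanned by a meet-irredundant set `s`: the meets of all members but one are, over the
meet of all of `s`, the atoms of a Boolean sublattice. -/
theorem IsMeetIrredundant.exists_cube {L : Type*} [DistribLattice L] [BoundedOrder L]
    {s : Finset L} (hs : IsMeetIrredundant s) :
    ∃ φ : (Fin s.card → Bool) → L, Function.Injective φ ∧ IsMedianPreserving φ := by
  classical
  let e : Fin s.card ≃ s := s.equivFin.symm
  let o : L := s.inf id
  let y : Fin s.card → L := fun i => (s.erase (e i)).inf id
  have hy (i j) (hij : i ≠ j) : y i ⊓ y j ≤ o := Finset.le_inf fun x hx => by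
    by_cases hxi : x = e i
    · refine inf_le_right.trans (Finset.inf_le (f := id) (Finset.mem_erase.2 ⟨?_, hx⟩))
      rintro rfl
      exact hij (e.injective (Subtype.ext hxi.symm))
    · exact inf_le_left.trans (Finset.inf_le (f := id) (Finset.mem_erase.2 ⟨hxi, hx⟩))
  have hyo (i) : ¬ y i ≤ o := fun h =>
    hs (e i) (e i).2 (s.erase (e i)) (Finset.erase_subset _ _) (Finset.notMem_erase _ _)
      (h.trans (Finset.inf_le (f := id) (e i).2))
  let S : (Fin s.card → Bool) → Finset (Fin s.card) := fun ε => Finset.univ.filter (ε · = true)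
  let φ : (Fin s.card → Bool) → L := fun ε => o ⊔ (S ε).sup y
  have hmono {ε δ} (h : φ ε ≤ φ δ) (i) (hi : ε i = true) : δ i = true := by
    by_contra hδ
    have h1 : y i ≤ φ δ := le_trans (le_trans (Finset.le_sup (f := y) (by simp [S, hi]))
      le_sup_right) h
    refine hyo i ?_
    rw [← inf_eq_left.2 h1, inf_sup_left, Finset.sup_inf_distrib_left]
    refine sup_le inf_le_right (Finset.sup_le fun j hj => hy i j ?_)
    rintro rfl
    simp [S, hδ] at hj
  refine ⟨φ, fun ε δ h => funext fun i => Bool.eq_iff_iff.2 ⟨hmono h.le i, hmono h.ge i⟩,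
    isMedianPreserving_of_map_inf_sup (fun ε δ => ?_) fun ε δ => ?_⟩
  · have hS : S (ε ⊓ δ) = S ε ∩ S δ := by ext; simp [S]
    change o ⊔ _ = (o ⊔ _) ⊓ (o ⊔ _)
    rw [hS, ← sup_inf_left]
    refine le_antisymm (sup_le_sup_left (le_inf (Finset.sup_mono Finset.inter_subset_left)
      (Finset.sup_mono Finset.inter_subset_right)) _) (sup_le le_sup_left ?_)
    rw [Finset.sup_inf_sup]
    refine Finset.sup_le fun p hp => ?_
    rw [Finset.mem_product] at hp
    by_cases hij : p.1 = p.2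
    · exact inf_le_left.trans (le_trans (Finset.le_sup (f := y)
        (Finset.mem_inter.2 ⟨hp.1, hij ▸ hp.2⟩)) le_sup_right)
    · exact (hy _ _ hij).trans le_sup_left
  · have hS : S (ε ⊔ δ) = S ε ∪ S δ := by ext; simp [S]
    change o ⊔ _ = (o ⊔ _) ⊔ (o ⊔ _)
    rw [hS, Finset.sup_union, ← sup_sup_distrib_left]

theorem le_rank {n : ℕ} {φ : (Fin n → Bool) → X} (hφ : Function.Injective φ)
    (hm : IsMedianPreserving φ) : (n : ℕ∞) ≤ rank X :=
  le_iSup₂_of_le n ⟨φ, hφ, hm⟩ le_rfl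

theorem IsMeetIrredundant.card_le_rank {a b : X} {s : Finset (Interval a b)}
    (hs : IsMeetIrredundant s) : (s.card : ℕ∞) ≤ rank X :=
  let ⟨_, hφ, hm⟩ := hs.exists_cube
  le_rank (Interval.val_injective.comp hφ) (Interval.isMedianPreserving_val.comp hm)

/-- If every sign pattern occurs for `k` median-preserving functions, then, after projecting to the
interval between the all-low and the all-high point, the points at which exactly one of the
functions is low form a meet-irredundant set. -/
theorem le_rank_of_isIndependent {k : ℕ} {f : Fin k → X → ℝ}
    (hf : ∀ i, ∃ g : X → unitInterval, IsMedianPreserving g ∧ f i = fun x => (g x : ℝ))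
    (h : IsIndependent f) : (k : ℕ∞) ≤ rank X := by
  classical
  choose g hg hfg using hf
  obtain ⟨α, β, hαβ, h⟩ := h
  have hpt (P : Finset (Fin k)) : ∃ x, ∀ i, (i ∈ P → (g i x : ℝ) ≤ α) ∧ (i ∉ P → β ≤ g i x) := by
    obtain ⟨x, hx⟩ := h P Pᶜ disjoint_compl_right
    simp only [hfg, mem_inter_iff, mem_iInter, mem_preimage, mem_Iic, mem_Ici,
      Finset.mem_compl] at hx
    exact ⟨x, fun i => ⟨hx.1 i, hx.2 i⟩⟩
  choose p hp using hpt
  let a := p Finset.univ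
  let b := p ∅
  have ha (i) : (g i a : ℝ) ≤ α := (hp _ i).1 (Finset.mem_univ i)
  have hb (i) : β ≤ g i b := (hp _ i).2 (Finset.notMem_empty i)
  let z (i : Fin k) : Interval a b := Interval.proj a b (p {i})
  have hmed (u v w : unitInterval) : ((med u v w : unitInterval) : ℝ) =
      max (max (min (u : ℝ) v) (min (v : ℝ) w)) (min (w : ℝ) u) := rfl
  have hz (i j) : (g j (z i).1 : ℝ) = max (max (min (g j (p {i}) : ℝ) (g j a))
      (min (g j a : ℝ) (g j b))) (min (g j b : ℝ) (g j (p {i}))) := by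
    rw [← hmed, ← hg]; rfl
  have hlow (i) : (g i (z i).1 : ℝ) ≤ α := by
    have := (hp {i} i).1 (Finset.mem_singleton_self i)
    rw [hz]
    simp only [max_le_iff, min_le_iff, ha i, this, true_or, or_true, and_self]
  have hhigh (i j) (hij : j ≠ i) : β ≤ (g j (z i).1 : ℝ) := by
    have := (hp {i} j).2 (by simpa using hij)
    rw [hz]
    simp only [le_max_iff, le_min_iff, hb j, this, and_self, or_true]
  have hmon (j) {u v : Interval a b} (huv : u ≤ v) (hv : (g j v.1 : ℝ) ≤ α) :
      (g j u.1 : ℝ) ≤ α := by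
    have e : med a u.1 v.1 = u.1 := congrArg Interval.val (inf_eq_left.2 huv)
    rw [← e, hg, hmed]
    simp only [max_le_iff, min_le_iff, ha j, hv, true_or, or_true, and_self]
  have hinf (j) (t : Finset (Interval a b)) (ht : ∀ u ∈ t, β ≤ (g j u.1 : ℝ)) :
      β ≤ (g j (t.inf id).1 : ℝ) := by
    refine Finset.inf_induction (p := fun u : Interval a b => β ≤ (g j u.1 : ℝ)) (hb j) ?_ ht
    intro u hu v hv
    rw [Interval.val_inf, hg, hmed]
    simp only [le_max_iff, le_min_iff, hu, hv, and_self, or_true, true_or]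
  have hinj : Function.Injective z := fun i j hij => by
    by_contra hne
    have := hhigh j i hne
    rw [← hij] at this
    exact absurd (hlow i) (not_le.2 (hαβ.trans_le this))
  have hirr : IsMeetIrredundant (Finset.univ.map ⟨z, hinj⟩) := by
    intro x hx t ht hxt hle
    obtain ⟨i, -, rfl⟩ := Finset.mem_map.1 hx
    refine absurd (hmon i hle (hlow i)) (not_le.2 (hαβ.trans_le (hinf i t fun u hu => ?_)))
    obtain ⟨j, -, rfl⟩ := Finset.mem_map.1 (ht hu)
    refine hhigh j i ?_
    rintro rfl
    exact hxt hu
  simpa using hirr.card_le_rank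

end Algebra

/-! ### Compact distributive lattices of finite breadth -/

section CompactLattice

theorem orderClosedTopology_of_continuousInf {L : Type*} [Lattice L] [TopologicalSpace L]
    [T2Space L] [ContinuousInf L] : OrderClosedTopology L where
  isClosed_le' := by
    simp only [← inf_eq_left]
    exact isClosed_eq (continuous_fst.inf continuous_snd) continuous_fst

theorem exists_isLUB_mem_closure {L : Type*} [PartialOrder L] [TopologicalSpace L]
    [CompactSpace L] [OrderClosedTopology L] {D : Set L} (hne : D.Nonempty)
    (hD : DirectedOn (· ≤ ·) D) : ∃ z ∈ closure D, IsLUB D z := by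
  have : Nonempty D := hne.to_subtype
  obtain ⟨z, hz⟩ := IsCompact.nonempty_iInter_of_directed_nonempty_isCompact_isClosed
    (fun d : D => closure (D ∩ Ici d.1))
    (fun d e => by
      obtain ⟨f, hf, hdf, hef⟩ := hD d.1 d.2 e.1 e.2
      exact ⟨⟨f, hf⟩, closure_mono (inter_subset_inter_right _ (Ici_subset_Ici.2 hdf)),
        closure_mono (inter_subset_inter_right _ (Ici_subset_Ici.2 hef))⟩)
    (fun d => ⟨d.1, subset_closure ⟨d.2, le_rfl⟩⟩)
    (fun _ => isClosed_closure.isCompact) (fun _ => isClosed_closure)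
  rw [mem_iInter] at hz
  have hzD : z ∈ closure D := closure_mono inter_subset_left (hz (Classical.arbitrary D))
  refine ⟨z, hzD, fun d hd => ?_, fun u hu => ?_⟩
  · exact closure_minimal inter_subset_right isClosed_Ici (hz ⟨d, hd⟩)
  · exact closure_minimal hu isClosed_Iic hzD

theorem exists_isGLB_mem_closure {L : Type*} [PartialOrder L] [TopologicalSpace L]
    [CompactSpace L] [OrderClosedTopology L] {D : Set L} (hne : D.Nonempty)
    (hD : DirectedOn (· ≥ ·) D) : ∃ z ∈ closure D, IsGLB D z :=
  have : CompactSpace Lᵒᵈ := ‹CompactSpace L›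
  exists_isLUB_mem_closure (L := Lᵒᵈ) hne hD

variable {L : Type*} [DistribLattice L] [BoundedOrder L]

theorem exists_nhds_forall_inf_mem [TopologicalSpace L] [ContinuousInf L] {x : L} (n : ℕ)
    {C : Set L} (hC : C ∈ 𝓝 x) :
    ∃ V ∈ 𝓝 x, ∀ t : Finset L, t.card ≤ n → ↑t ⊆ V → x ⊓ t.inf id ∈ C := by
  classical
  induction n generalizing C with
  | zero =>
    refine ⟨univ, univ_mem, fun t ht _ => ?_⟩
    rw [Finset.card_eq_zero.1 (Nat.le_zero.1 ht), Finset.inf_empty, inf_top_eq]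
    exact mem_of_mem_nhds hC
  | succ n ih =>
    have h : Tendsto (fun p : L × L => p.1 ⊓ p.2) (𝓝 x ×ˢ 𝓝 x) (𝓝 x) := by
      have := (continuous_inf (L := L)).tendsto (x, x)
      rwa [nhds_prod_eq, inf_idem] at this
    obtain ⟨U, hU, W, hW, hUW⟩ := mem_prod_iff.1 (h hC)
    obtain ⟨V, hV, hVW⟩ := ih hW
    refine ⟨U ∩ V, inter_mem hU hV, fun t ht htV => ?_⟩
    obtain rfl | ⟨u, hu⟩ := t.eq_empty_or_nonempty
    · rw [Finset.inf_empty, inf_top_eq]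
      exact mem_of_mem_nhds hC
    · have h1 := hVW (t.erase u) (by rw [Finset.card_erase_of_mem hu]; omega)
        fun w hw => (htV (Finset.erase_subset _ _ hw)).2
      have h2 := hUW (mk_mem_prod (htV hu).1 h1)
      rw [← Finset.insert_erase hu, Finset.inf_insert, inf_left_comm]
      exact h2

theorem exists_isMeetIrredundant_subset (s : Finset L) :
    ∃ t ⊆ s, t.inf id = s.inf id ∧ IsMeetIrredundant t := by
  classical
  induction s using Finset.strongInduction with
  | H s ih =>
    by_cases hs : IsMeetIrredundant s
    · exact ⟨s, subset_rfl, rfl, hs⟩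
    · simp only [IsMeetIrredundant, not_forall, not_not] at hs
      obtain ⟨x, hx, t, hts, hxt, hle⟩ := hs
      obtain ⟨r, hr, hri, hirr⟩ := ih _ (Finset.erase_ssubset hx)
      refine ⟨r, hr.trans (Finset.erase_subset _ _), ?_, hirr⟩
      rw [hri]
      refine le_antisymm (Finset.le_inf fun y hy => ?_) (Finset.inf_mono (Finset.erase_subset _ _))
      by_cases hyx : y = x
      · subst hyx
        refine le_trans (Finset.inf_mono fun w hw => ?_) hle
        exact Finset.mem_erase.2 ⟨fun h => hxt (h ▸ hw), hts hw⟩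
      · exact Finset.inf_le (f := id) (Finset.mem_erase.2 ⟨hyx, hy⟩)

/-- Finite breadth makes neighbourhoods generate small meet-subsemilattices: a point `x` not below
`y` has a neighbourhood with a lower bound that is still not below `y`. -/
theorem exists_nhds_lowerBound [TopologicalSpace L] [CompactSpace L] [T2Space L]
    [ContinuousInf L] {n : ℕ}
    (hn : ∀ s : Finset L, IsMeetIrredundant s → s.card ≤ n) {x y : L} (hxy : ¬ x ≤ y) :
    ∃ V ∈ 𝓝 x, ∃ g, ¬ g ≤ y ∧ g ∈ lowerBounds V := by
  classical
  have : OrderClosedTopology L := orderClosedTopology_of_continuousInf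
  obtain ⟨C, hC, hCc, hCy⟩ := exists_mem_nhds_isClosed_subset
    ((isClosed_Iic (a := y)).isOpen_compl.mem_nhds hxy)
  obtain ⟨V, hV, hVC⟩ := exists_nhds_forall_inf_mem n hC
  let D : Set L := {w | ∃ t : Finset L, ↑t ⊆ V ∧ x ⊓ t.inf id = w}
  have hDC : D ⊆ C := by
    rintro _ ⟨t, ht, rfl⟩
    obtain ⟨r, hr, hri, hirr⟩ := exists_isMeetIrredundant_subset t
    rw [← hri]
    exact hVC r (hn r hirr) (subset_trans (Finset.coe_subset.2 hr) ht)
  obtain ⟨g, hg, hglb⟩ := exists_isGLB_mem_closure (D := D) ⟨_, ∅, by simp, rfl⟩ (by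
    rintro _ ⟨t, ht, rfl⟩ _ ⟨r, hr, rfl⟩
    exact ⟨_, ⟨t ∪ r, by simp [ht, hr], rfl⟩,
      inf_le_inf_left _ (Finset.inf_mono Finset.subset_union_left),
      inf_le_inf_left _ (Finset.inf_mono Finset.subset_union_right)⟩)
  refine ⟨V, hV, g, hCy (closure_minimal hDC hCc hg), fun v hv => ?_⟩
  exact (hglb.1 ⟨{v}, by simpa using hv, rfl⟩).trans (by simp)

/-- In a distributive lattice of finite breadth, the complement of a filter `G` is a union of
finitely many ideals, namely of the sets `{w | w ⊔ z ∉ G}` for `z` in a largest possible set `T`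
of elements outside `G` whose pairwise joins lie in `G`. -/
theorem exists_finite_ideal_cover {n : ℕ}
    (hn : ∀ s : Finset L, IsMeetIrredundant s → s.card ≤ n) {G : Set L} (hup : IsUpperSet G)
    (htop : ⊤ ∈ G) (hinf : ∀ u ∈ G, ∀ v ∈ G, u ⊓ v ∈ G) :
    ∃ T : Finset L, (∀ z ∈ T, z ∉ G) ∧ (∀ w, w ∉ G → ∃ z ∈ T, w ⊔ z ∉ G) ∧
      ∀ z ∈ T, ∀ u v, u ⊔ z ∉ G → v ⊔ z ∉ G → u ⊔ v ⊔ z ∉ G := by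
  classical
  let Good : Set (Finset L) := {T | (∀ z ∈ T, z ∉ G) ∧ ∀ z ∈ T, ∀ w ∈ T, z ≠ w → z ⊔ w ∈ G}
  have hcard (T) (hT : T ∈ Good) : T.card ≤ n := by
    refine hn T fun z hz t ht hzt hle => hT.1 z hz ?_
    rw [← sup_eq_left.2 hle, Finset.inf_sup_distrib_left]
    refine Finset.inf_induction (p := (· ∈ G)) htop hinf fun w hw => ?_
    exact hT.2 z hz w (ht hw) fun h => hzt (h ▸ hw)
  obtain ⟨T, hT, hmax⟩ := (measure fun T : Finset L => n - T.card).wf.has_min Good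
    ⟨∅, by simp [Good]⟩
  have hmax (T') (hT' : T' ∈ Good) : T'.card ≤ T.card := by
    have h1 := hmax T' hT'
    have h2 := hcard T' hT'
    change ¬ (n - T'.card < n - T.card) at h1
    omega
  refine ⟨T, hT.1, fun w hw => ?_, fun z hz u v hu hv huv => ?_⟩
  · by_contra! hcov
    have hwT : w ∉ T := fun h => hw (by simpa using hcov w h)
    have := hmax (insert w T) ⟨by simpa [hw] using hT.1, fun p hp q hq hpq => by
      rw [Finset.mem_insert] at hp hq
      obtain rfl | hp := hp <;> obtain rfl | hq := hq
      · exact absurd rfl hpq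
      · exact hcov q hq
      · rw [sup_comm]; exact hcov p hp
      · exact hT.2 p hp q hq hpq⟩
    rw [Finset.card_insert_of_notMem hwT] at this
    omega
  · -- Otherwise `z` could be replaced by the two elements `u ⊔ z` and `v ⊔ z`.
    have hz' (w) (hw : w ∈ T.erase z) (p : L) : p ⊔ z ⊔ w ∈ G := by
      rw [sup_assoc]
      exact hup le_sup_right (hT.2 z hz w (Finset.mem_of_mem_erase hw)
        (Finset.ne_of_mem_erase hw).symm)
    have hnot (p) (hp : p ⊔ z ∉ G) : p ⊔ z ∉ T.erase z := fun h => hp (by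
      simpa using hz' _ h p)
    have huv' : u ⊔ z ⊔ (v ⊔ z) ∈ G := by rwa [← sup_sup_distrib_right]
    have hne : u ⊔ z ∉ insert (v ⊔ z) (T.erase z) := by
      rw [Finset.mem_insert, not_or]
      refine ⟨fun h => hv ?_, hnot u hu⟩
      rwa [h, sup_idem] at huv'
    have := hmax (insert (u ⊔ z) (insert (v ⊔ z) (T.erase z))) ⟨fun p hp => by
      simp only [Finset.mem_insert] at hp
      obtain rfl | rfl | hp := hp
      · exact hu
      · exact hv
      · exact hT.1 p (Finset.mem_of_mem_erase hp), fun p hp q hq hpq => by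
      simp only [Finset.mem_insert] at hp hq
      obtain rfl | rfl | hp := hp <;> obtain rfl | rfl | hq := hq
      · exact absurd rfl hpq
      · exact huv'
      · exact hz' q hq u
      · rwa [sup_comm]
      · exact absurd rfl hpq
      · exact hz' q hq v
      · rw [sup_comm]; exact hz' p hp u
      · rw [sup_comm]; exact hz' p hp v
      · exact hT.2 p (Finset.mem_of_mem_erase hp) q (Finset.mem_of_mem_erase hq) hpq⟩
    rw [Finset.card_insert_of_notMem hne, Finset.card_insert_of_notMem (hnot v hv),
      Finset.card_erase_of_mem hz] at this
    have := Finset.card_pos.2 ⟨z, hz⟩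
    omega

/-- The relation `c ⋘ d` of completely distributive lattices: the lattice is covered by the
principal filter of `c` and a principal ideal that does not contain `d`. -/
def WellBelow {L : Type*} [LE L] (c d : L) : Prop :=
  ∃ e, (∀ z, c ≤ z ∨ z ≤ e) ∧ ¬ d ≤ e

/-- Every element is the join of the elements well below it. -/
theorem exists_wellBelow_not_le [TopologicalSpace L] [CompactSpace L] [T2Space L]
    [ContinuousInf L] [ContinuousSup L] {n : ℕ}
    (hn : ∀ s : Finset L, IsMeetIrredundant s → s.card ≤ n) {x y : L} (hxy : ¬ x ≤ y) :
    ∃ c, WellBelow c x ∧ ¬ c ≤ y := by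
  classical
  have : OrderClosedTopology L := orderClosedTopology_of_continuousInf
  obtain ⟨V, hV, g, hgy, hgV⟩ := exists_nhds_lowerBound hn hxy
  let G : Set L := {z | ∃ t : Finset L, ↑t ⊆ V ∧ t.inf id ≤ z}
  have hup : IsUpperSet G := fun u v huv ⟨t, ht, htu⟩ => ⟨t, ht, htu.trans huv⟩
  have hinf : ∀ u ∈ G, ∀ v ∈ G, u ⊓ v ∈ G := fun u ⟨t, ht, htu⟩ v ⟨r, hr, hrv⟩ =>
    ⟨t ∪ r, by simp [ht, hr], by rw [Finset.inf_union]; exact inf_le_inf htu hrv⟩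
  have hVG : V ⊆ G := fun v hv => ⟨{v}, by simpa using hv, by simp⟩
  have hGg : G ⊆ Ici g := fun u ⟨t, ht, htu⟩ =>
    (Finset.le_inf fun v hv => hgV (ht hv)).trans htu
  have htop : (⊤ : L) ∈ G := ⟨∅, by simp, le_top⟩
  obtain ⟨T, hTG, hcov, hideal⟩ := exists_finite_ideal_cover hn hup htop hinf
  have hc (z : L) : ∃ c ∈ closure {w | w ⊔ z ∈ G}, IsGLB {w | w ⊔ z ∈ G} c :=
    exists_isGLB_mem_closure ⟨⊤, by simpa using htop⟩ fun u hu v hv =>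
      ⟨u ⊓ v, by simpa [sup_inf_right] using hinf _ hu _ hv, inf_le_left, inf_le_right⟩
  choose c hcc hcg using hc
  -- The join of the `c z` is a limit of elements of `G`, hence it lies above `g`.
  have hT : ∃ z ∈ T, ¬ c z ≤ y := by
    by_contra! h
    have hsup (S : Finset L) : S.sup c ∈ closure {w | ∀ z ∈ S, w ⊔ z ∈ G} := by
      induction S using Finset.induction_on with
      | empty => simp
      | insert a S _ ih =>
        rw [Finset.sup_insert]
        refine map_mem_closure₂ continuous_sup (hcc a) ih fun p hp q hq z hz => ?_
        obtain rfl | hz := Finset.mem_insert.1 hz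
        · exact hup (sup_le_sup_right le_sup_left _) hp
        · exact hup (sup_le_sup_right le_sup_right _) (hq z hz)
    have hsub : {w | ∀ z ∈ T, w ⊔ z ∈ G} ⊆ Ici g := fun w hw => hGg (by
      by_contra hwG
      obtain ⟨z, hz, hwz⟩ := hcov w hwG
      exact hwz (hw z hz))
    exact hgy ((closure_minimal hsub isClosed_Ici (hsup T)).trans (Finset.sup_le h))
  obtain ⟨z, hz, hzy⟩ := hT
  obtain ⟨e, hec, he⟩ := exists_isLUB_mem_closure (D := {w | w ⊔ z ∉ G})
    ⟨⊥, by simpa using hTG z hz⟩ fun u hu v hv =>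
      ⟨u ⊔ v, hideal z hz u v hu hv, le_sup_left, le_sup_right⟩
  refine ⟨c z, ⟨e, fun w => ?_, fun hxe => ?_⟩, hzy⟩
  · by_cases hw : w ⊔ z ∈ G
    · exact Or.inl ((hcg z).1 hw)
    · exact Or.inr (he.1 hw)
  · -- The ideal with supremum `e` would have `x` in its closure, but it misses `V`.
    have hx : x ∈ closure {w | w ⊔ z ∉ G} := by
      rw [← inf_eq_left.2 hxe]
      exact map_mem_closure (continuous_const.inf continuous_id) hec fun w hw h =>
        hw (hup (sup_le_sup_right inf_le_right _) h)
    obtain ⟨v, hv, hvz⟩ := mem_closure_iff_nhds.1 hx V hV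
    exact hvz (hup le_sup_left (hVG hv))

theorem WellBelow.le {L : Type*} [LE L] {c d : L} (h : WellBelow c d) : c ≤ d :=
  let ⟨_, h1, h2⟩ := h
  (h1 d).resolve_right h2

theorem WellBelow.trans_le {L : Type*} [Preorder L] {c d x : L} (h : WellBelow c d) (hx : d ≤ x) :
    WellBelow c x :=
  let ⟨e, h1, h2⟩ := h
  ⟨e, h1, fun h => h2 (hx.trans h)⟩

/-- Approximation from well below yields interpolation. -/
theorem WellBelow.exists_between {L : Type*} [LE L]
    (H : ∀ x y : L, ¬ x ≤ y → ∃ c, WellBelow c x ∧ ¬ c ≤ y)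
    {c d : L} (h : WellBelow c d) : ∃ m, WellBelow c m ∧ WellBelow m d :=
  let ⟨e, h1, h2⟩ := h
  let ⟨m, hm, hme⟩ := H d e h2
  ⟨m, ⟨e, h1, hme⟩, hm⟩

end CompactLattice

/-! ### Dyadic chains -/

section Chain

/-- A transitive relation with interpolation contains, between any two related elements, a chain
indexed by the dyadic rationals of `[0,1]`. The chain is given as the set of the pairs of an index
and the element at that index. -/
theorem exists_dyadic_chain {α : Type*} {r : α → α → Prop}
    (htrans : ∀ a b c, r a b → r b c → r a c) (hint : ∀ a b, r a b → ∃ c, r a c ∧ r c b)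
    {a b : α} (hab : r a b) :
    ∃ R : Set (ℝ × α), (0, a) ∈ R ∧ (1, b) ∈ R ∧ (∀ p ∈ R, 0 ≤ p.1 ∧ p.1 ≤ 1) ∧
      (∀ p ∈ R, ∀ q ∈ R, p.1 < q.1 → r p.2 q.2) ∧
      ∀ s t : ℝ, 0 ≤ s → s < t → t ≤ 1 → ∃ p ∈ R, s < p.1 ∧ p.1 < t := by
  classical
  have : Nonempty α := ⟨a⟩
  choose! m hm1 hm2 using hint
  let c : ℕ → ℕ → α := fun n => n.rec (fun k => if k = 0 then a else b)
    fun _ ih k => if k % 2 = 0 then ih (k / 2) else m (ih (k / 2)) (ih (k / 2 + 1))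
  have c0 (k) : c 0 k = if k = 0 then a else b := rfl
  have cs (n k) : c (n + 1) k =
    if k % 2 = 0 then c n (k / 2) else m (c n (k / 2)) (c n (k / 2 + 1)) := rfl
  have hstep (n) : ∀ k < 2 ^ n, r (c n k) (c n (k + 1)) := by
    induction n with
    | zero =>
      intro k hk
      obtain rfl : k = 0 := by simpa using hk
      simpa [c0] using hab
    | succ n ih =>
      intro k hk
      have h := ih (k / 2) (by rw [pow_succ] at hk; omega)
      rw [cs, cs]
      obtain hk2 | hk2 := Nat.mod_two_eq_zero_or_one k
      · rw [if_pos hk2, if_neg (by omega), show (k + 1) / 2 = k / 2 by omega]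
        exact hm1 _ _ h
      · rw [if_neg (by omega), if_pos (by omega), show (k + 1) / 2 = k / 2 + 1 by omega]
        exact hm2 _ _ h
  have hlt (n j k) (hjk : j < k) (hk : k ≤ 2 ^ n) : r (c n j) (c n k) := by
    induction k, hjk using Nat.le_induction with
    | base => exact hstep n j hk
    | succ k hjk ih => exact htrans _ _ _ (ih (by omega)) (hstep n k hk)
  have href (n l k) : c (n + l) (k * 2 ^ l) = c n k := by
    induction l with
    | zero => simp
    | succ l ih =>
      rw [← add_assoc, cs, pow_succ, ← mul_assoc, Nat.mul_mod_left, if_pos rfl,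
        Nat.mul_div_cancel _ two_pos, ih]
  refine ⟨{p | ∃ n k : ℕ, k ≤ 2 ^ n ∧ p = ((k : ℝ) / 2 ^ n, c n k)}, ⟨0, 0, by simp, by simp [c0]⟩,
    ⟨0, 1, by simp, by simp [c0]⟩, ?_, ?_, ?_⟩
  · rintro _ ⟨n, k, hk, rfl⟩
    have hk' : (k : ℝ) ≤ 2 ^ n := by exact_mod_cast hk
    exact ⟨by positivity, div_le_one_of_le₀ hk' (by positivity)⟩
  · rintro _ ⟨n, j, hj, rfl⟩ _ ⟨l, k, hk, rfl⟩ hjk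
    dsimp only at hjk ⊢
    rw [div_lt_div_iff₀ (by positivity) (by positivity)] at hjk
    have hjk : j * 2 ^ l < k * 2 ^ n := by exact_mod_cast hjk
    rw [← href n l j, ← href l n k, add_comm l n]
    refine hlt _ _ _ hjk ?_
    rw [pow_add, mul_comm (2 ^ n)]
    exact Nat.mul_le_mul_right _ hk
  · intro s t hs hst ht
    obtain ⟨n, hn⟩ := exists_pow_lt_of_lt_one (sub_pos.2 hst) (by norm_num : (1 / 2 : ℝ) < 1)
    rw [one_div, inv_pow, inv_lt_iff_one_lt_mul₀ (by positivity)] at hn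
    have hpos : (0 : ℝ) < 2 ^ n := by positivity
    have h1 := Nat.lt_floor_add_one (s * 2 ^ n)
    have h2 := Nat.floor_le (mul_nonneg hs hpos.le)
    have h3 : ((⌊s * 2 ^ n⌋₊ + 1 : ℕ) : ℝ) < t * 2 ^ n := by push_cast; linarith
    refine ⟨_, ⟨n, ⌊s * 2 ^ n⌋₊ + 1, ?_, rfl⟩, ?_, ?_⟩
    · have : ((⌊s * 2 ^ n⌋₊ + 1 : ℕ) : ℝ) ≤ 2 ^ n := h3.le.trans (mul_le_of_le_one_left hpos.le ht)
      exact_mod_cast this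
    · rw [lt_div_iff₀ hpos]; exact_mod_cast h1
    · rwa [div_lt_iff₀ hpos]

end Chain

/-! ### Continuous median-preserving maps to the unit interval -/

section Separation

/-- The height function `x ↦ sSup {t | c t ≤ x}` along a dyadic chain `c` for the relation
`WellBelow` is a continuous lattice homomorphism. -/
theorem exists_continuous_hom_of_wellBelow {L : Type*} [DistribLattice L] [BoundedOrder L]
    [TopologicalSpace L] [OrderClosedTopology L] (hL : ¬ (⊤ : L) ≤ ⊥)
    (H : ∀ x y : L, ¬ x ≤ y → ∃ c, WellBelow c x ∧ ¬ c ≤ y) :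
    ∃ f : L → unitInterval, Continuous f ∧ IsMedianPreserving f ∧ f ⊥ = 0 ∧ f ⊤ = 1 := by
  obtain ⟨R, h0, h1, hR, hlt, hdense⟩ := exists_dyadic_chain (r := WellBelow)
    (fun _ _ _ hab hbc => hab.trans_le hbc.le) (fun _ _ h => h.exists_between H)
    (⟨⊥, fun _ => Or.inl bot_le, hL⟩ : WellBelow (⊥ : L) ⊤)
  let A : L → Set ℝ := fun x => {t | ∃ c, (t, c) ∈ R ∧ c ≤ x}
  let F : L → ℝ := fun x => sSup (A x)
  have hA0 (x) : (0 : ℝ) ∈ A x := ⟨⊥, h0, bot_le⟩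
  have hbdd (x) : BddAbove (A x) := ⟨1, fun t ⟨c, hc, _⟩ => (hR _ hc).2⟩
  have hle {t c x} (hc : (t, c) ∈ R) (hcx : c ≤ x) : t ≤ F x := le_csSup (hbdd x) ⟨c, hc, hcx⟩
  have hF0 (x) : 0 ≤ F x := le_csSup (hbdd x) (hA0 x)
  have hF1 (x) : F x ≤ 1 := csSup_le ⟨0, hA0 x⟩ fun t ⟨c, hc, _⟩ => (hR _ hc).2
  have hexists {s x} (h : s < F x) : ∃ t c, (t, c) ∈ R ∧ s < t ∧ c ≤ x := by
    obtain ⟨t, ⟨c, hc, hcx⟩, hst⟩ := exists_lt_of_lt_csSup ⟨0, hA0 x⟩ h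
    exact ⟨t, c, hc, hst, hcx⟩
  have hmono : Monotone F := fun x y hxy =>
    csSup_le ⟨0, hA0 x⟩ fun t ⟨c, hc, hcx⟩ => hle hc (hcx.trans hxy)
  have hinf (x y) : F (x ⊓ y) = F x ⊓ F y := by
    refine le_antisymm (hmono.map_inf_le x y) (le_of_forall_lt fun s hs => ?_)
    obtain hs0 | hs0 := lt_or_ge s 0
    · exact hs0.trans_le (hF0 _)
    obtain ⟨t, c, hc, hst, hcx⟩ := hexists (lt_inf_iff.1 hs).1
    obtain ⟨t', c', hc', hst', hcy⟩ := hexists (lt_inf_iff.1 hs).2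
    obtain ⟨⟨q, d⟩, hd, hsq, hqt⟩ := hdense s (min t t') hs0 (lt_min hst hst')
      ((min_le_left _ _).trans (hR _ hc).2)
    exact hsq.trans_le (hle hd (le_inf
      ((hlt _ hd _ hc (hqt.trans_le (min_le_left _ _))).le.trans hcx)
      ((hlt _ hd _ hc' (hqt.trans_le (min_le_right _ _))).le.trans hcy)))
  have hsup (x y) : F (x ⊔ y) = F x ⊔ F y := by
    refine le_antisymm (le_of_forall_lt fun s hs => ?_) (hmono.le_map_sup x y)
    obtain hs0 | hs0 := lt_or_ge s 0
    · exact hs0.trans_le ((hF0 x).trans le_sup_left)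
    obtain ⟨t, c, hc, hst, hcxy⟩ := hexists hs
    obtain ⟨⟨q, d⟩, hd, hsq, hqt⟩ := hdense s t hs0 hst (hR _ hc).2
    obtain ⟨e, he, hce⟩ := hlt _ hd _ hc hqt
    obtain hx | hx := he x
    · exact hsq.trans_le ((hle hd hx).trans le_sup_left)
    obtain hy | hy := he y
    · exact hsq.trans_le ((hle hd hy).trans le_sup_right)
    · exact absurd (hcxy.trans (sup_le hx hy)) hce
  have hcont : Continuous F := by
    refine continuous_iff_continuousAt.2 fun x => tendsto_order.2 ⟨fun s hs => ?_, fun s hs => ?_⟩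
    · obtain hs0 | hs0 := lt_or_ge s 0
      · exact Eventually.of_forall fun z => hs0.trans_le (hF0 z)
      obtain ⟨t, c, hc, hst, hcx⟩ := hexists hs
      obtain ⟨⟨q, d⟩, hd, hsq, hqt⟩ := hdense s t hs0 hst (hR _ hc).2
      obtain ⟨e, he, hce⟩ := hlt _ hd _ hc hqt
      filter_upwards [(isClosed_Iic (a := e)).isOpen_compl.mem_nhds fun h => hce (hcx.trans h)]
        with z hz
      exact hsq.trans_le (hle hd ((he z).resolve_right hz))
    · obtain hs1 | hs1 := lt_or_ge 1 s
      · exact Eventually.of_forall fun z => (hF1 z).trans_lt hs1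
      obtain ⟨⟨q, d⟩, hd, hxq, hqs⟩ := hdense (F x) s (hF0 x) hs hs1
      filter_upwards [(isClosed_Ici (a := d)).isOpen_compl.mem_nhds fun h =>
        not_le.2 hxq (hle hd h)] with z hz
      refine (csSup_le ⟨0, hA0 z⟩ fun t ⟨c, hc, hcz⟩ => ?_).trans_lt hqs
      by_contra! hqt
      exact hz ((hlt _ hd _ hc hqt).le.trans hcz)
  refine ⟨fun x => ⟨F x, hF0 x, hF1 x⟩, hcont.subtype_mk _,
    isMedianPreserving_of_map_inf_sup (fun x y => Subtype.ext (hinf x y))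
      (fun x y => Subtype.ext (hsup x y)),
    Subtype.ext (le_antisymm (csSup_le ⟨0, hA0 ⊥⟩ fun t ⟨c, hc, hcb⟩ => ?_) (hF0 _)),
    Subtype.ext (le_antisymm (hF1 _) (hle h1 le_rfl))⟩
  by_contra! ht
  obtain ⟨e, -, he⟩ := hlt _ h0 _ hc ht
  exact he (hcb.trans bot_le)

variable {X : Type*} [MedianAlgebra X] [TopologicalSpace X]

namespace Interval

variable {a b : X}

instance : TopologicalSpace (Interval a b) := .induced val inferInstance

theorem isEmbedding_val : IsEmbedding (val : Interval a b → X) := ⟨⟨rfl⟩, val_injective⟩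

instance [T2Space X] : T2Space (Interval a b) := isEmbedding_val.t2Space

variable [IsTopological X]

theorem _root_.Continuous.med {Y : Type*} [TopologicalSpace Y] {f g h : Y → X}
    (hf : Continuous f) (hg : Continuous g) (hh : Continuous h) :
    Continuous fun y => med (f y) (g y) (h y) :=
  IsTopological.continuous_med.comp (hf.prodMk (hg.prodMk hh))

instance : ContinuousInf (Interval a b) where
  continuous_inf := isEmbedding_val.continuous_iff.2 <|
    continuous_const.med (isEmbedding_val.continuous.comp continuous_fst)
      (isEmbedding_val.continuous.comp continuous_snd)

instance : ContinuousSup (Interval a b) where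
  continuous_sup := isEmbedding_val.continuous_iff.2 <|
    continuous_const.med (isEmbedding_val.continuous.comp continuous_fst)
      (isEmbedding_val.continuous.comp continuous_snd)

theorem continuous_proj (a b : X) : Continuous (proj a b) :=
  isEmbedding_val.continuous_iff.2 (continuous_id.med continuous_const continuous_const)

instance [CompactSpace X] : CompactSpace (Interval a b) :=
  Function.Surjective.compactSpace (f := proj a b) (continuous_proj a b)
    fun x => ⟨x.1, Interval.ext x.2⟩

end Interval

/-- In a compact median algebra of finite rank, distinct points are separated by continuous
median-preserving maps to the unit interval. -/
theorem exists_continuous_hom_proj [IsTopological X] [CompactSpace X] (hr : rank X < ⊤) {a b : X}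
    (hab : a ≠ b) : ∃ f : X → unitInterval, Continuous f ∧ IsMedianPreserving f ∧
      (∀ x, med x a b = a → f x = 0) ∧ ∀ x, med x a b = b → f x = 1 := by
  obtain ⟨n, hn⟩ := ENat.ne_top_iff_exists.1 hr.ne
  have hbr (s : Finset (Interval a b)) (hs : IsMeetIrredundant s) : s.card ≤ n := by
    have := hs.card_le_rank
    rw [← hn] at this
    exact_mod_cast this
  have : OrderClosedTopology (Interval a b) := orderClosedTopology_of_continuousInf
  obtain ⟨f, hc, hm, h0, h1⟩ := exists_continuous_hom_of_wellBelow (L := Interval a b)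
    (fun h => hab (congrArg Interval.val (le_bot_iff.1 h)).symm)
    (fun _ _ h => exists_wellBelow_not_le hbr h)
  refine ⟨f ∘ Interval.proj a b, hc.comp (Interval.continuous_proj a b),
    hm.comp (Interval.isMedianPreserving_proj a b), fun x hx => ?_, fun x hx => ?_⟩
  · rw [Function.comp, ← h0]
    exact congrArg f (Interval.ext hx)
  · rw [Function.comp, ← h1]
    exact congrArg f (Interval.ext hx)

/-- The coordinates of a cube in a compact median algebra of finite rank extend to continuous
median-preserving maps on the whole algebra. -/
theorem exists_isIndependent [IsTopological X] [CompactSpace X] (hr : rank X < ⊤) {k : ℕ}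
    {φ : (Fin k → Bool) → X} (hφ : Function.Injective φ) (hm : IsMedianPreserving φ) :
    ∃ f : Fin k → X → ℝ, (∀ i, f i ∈ MC X) ∧ IsIndependent f := by
  classical
  let δ (i : Fin k) : Fin k → Bool := fun j => decide (j = i)
  have hne (i) : φ ⊥ ≠ φ (δ i) := fun h => by
    simpa [δ] using congrFun (hφ h) i
  choose g hg hgm hg0 hg1 using fun i => exists_continuous_hom_proj hr (hne i)
  -- The projection of the cube to its `i`-th edge at the origin reads off the `i`-th coordinate.
  have hmed (ε : Fin k → Bool) (i) : med ε ⊥ (δ i) = δ i ⊓ ε := by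
    simp [med, inf_comm]
  have h0 (ε i) (h : ε i = false) : g i (φ ε) = 0 := hg0 i _ <| by
    rw [← hm, hmed]
    congr 1
    funext j
    by_cases hj : j = i <;> simp [δ, hj, h]
  have h1 (ε i) (h : ε i = true) : g i (φ ε) = 1 := hg1 i _ <| by
    rw [← hm, hmed]
    congr 1
    funext j
    by_cases hj : j = i <;> simp [δ, hj, h]
  refine ⟨fun i x => g i x, fun i => ⟨g i, hg i, hgm i, rfl⟩, 0, 1, zero_lt_one,
    fun P M hPM => ⟨φ fun i => decide (i ∈ M), ?_, ?_⟩⟩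
  · refine mem_iInter₂.2 fun i hi => ?_
    have : g i (φ fun i => decide (i ∈ M)) = 0 :=
      h0 _ i (decide_eq_false (Finset.disjoint_left.1 hPM hi))
    simp [this]
  · refine mem_iInter₂.2 fun i hi => ?_
    have : g i (φ fun i => decide (i ∈ M)) = 1 := h1 _ i (decide_eq_true hi)
    simp [this]

end Separation

end MedianAlgebra

theorem theoremt {X : Type*} [MedianAlgebra X] [TopologicalSpace X]
    [MedianAlgebra.IsTopological X] :
    MedianAlgebra.ind (MedianAlgebra.MC X) ≤ MedianAlgebra.rank X ∧
      (CompactSpace X → MedianAlgebra.rank X < ⊤ →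
        MedianAlgebra.ind (MedianAlgebra.MC X) = MedianAlgebra.rank X) := by
  have h : MedianAlgebra.ind (MedianAlgebra.MC X) ≤ MedianAlgebra.rank X :=
    iSup₂_le fun k ⟨f, hf, hind⟩ => MedianAlgebra.le_rank_of_isIndependent
      (fun i => let ⟨g, _, hg, hfg⟩ := hf i; ⟨g, hg, hfg⟩) hind
  exact ⟨h, fun _ hr => le_antisymm h <| iSup₂_le fun k ⟨_, hφ, hm⟩ =>
    le_iSup₂_of_le k (MedianAlgebra.exists_isIndependent hr hφ hm) le_rfl⟩
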